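/- Let $N,m\ge 1$ be integers, let $p_1,q_1,p_2,q_2>0$ be real numbers, and let $\Phi,\Psi:(0,\infty)\to(0,\infty)$ be non-increasing functions such that, for $K\in\{\Phi,\Psi\}$, the function $x\mapsto K(|x|)$ belongs to $C(\mathbb R^N\setminus\{0\})\cap L^1_{\rm loc}(\mathbb R^N)$ and $\lim_{r\to\infty} r^N K(r)=\infty$. Let $u,v\in C^{2m}(\mathbb R^N)$ be non-negative functions such that $$\int_{|y|>1} v(y)^{p_1}\,\Phi\!\left(\tfrac{|y|}{2}\right)dy<\infty,\qquad \int_{|y|>1} u(y)^{p_2}\,\Psi\!\left(\tfrac{|y|}{2}\right)dy<\infty,$$ and such that, at every point $x\in\mathbb R^N$, $$(-\Delta)^m u(x)\ \ge\ \left(\int_{\mathbb R^N} v(y)^{p_1}\,\Phi(|y-x|)\,dy\right) v(x)^{q_1},\qquad (-\Delta)^m v(x)\ \ge\ \left(\int_{\mathbb R^N} u(y)^{p_2}\,\Psi(|y-x|)\,dy\right) u(x)^{q_2}.$$ Assume that either $p_1+q_1\ge 2$ and $p_2+q_2\ge 2$, or $p_1\ge 1$ and $p_2\ge 1$. Then,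 for all $1\le i\le m$, $$(-\Delta)^i u\ge 0\quad\text{and}\quad (-\Delta)^i v\ge 0\qquad\text{in }\mathbb R^N.$$ -/

import Mathlib

open MeasureTheory Filter Set

open scoped Laplacian

noncomputable section

/-- The space `ℝ^N` with its Euclidean norm. -/
abbrev RN (N : ℕ) : Type := EuclideanSpace ℝ (Fin N)

/-- The polyharmonic operator `(-Δ)^i` on real functions on `ℝ^N`: the operator `w ↦ -Δ w`,
applied `i` times. -/
def negLaplacianPow {N : ℕ} (i : ℕ) (u : RN N → ℝ) : RN N → ℝ :=
  (fun (w : RN N → ℝ) (x : RN N) => -(Δ w x))^[i] u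

/-- The conditions on a radial kernel profile `Ψ`: it is a positive non-increasing function on
`(0, ∞)`, the function `x ↦ Ψ(|x|)` is continuous on `ℝ^N \ {0}` and locally integrable on `ℝ^N`,
and `r^N Ψ(r) → ∞` as `r → ∞`. The value `Ψ 0` plays no role. -/
structure IsAdmissibleKernel (N : ℕ) (Ψ : ℝ → ℝ) : Prop where
  pos : ∀ r : ℝ, 0 < r → 0 < Ψ r
  continuousOn : ContinuousOn (fun x : RN N => Ψ ‖x‖) {0}ᶜ
  locallyIntegrable : LocallyIntegrable (fun x : RN N => Ψ ‖x‖) volume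
  antitoneOn : AntitoneOn Ψ (Ioi 0)
  tendsto : Tendsto (fun r : ℝ => r ^ N * Ψ r) atTop atTop

/-- The convolution `(Ψ(|·|) * w)(x) = ∫ w(y) Ψ(|y - x|) dy` over `ℝ^N`. -/
def radialConv {N : ℕ} (Ψ : ℝ → ℝ) (w : RN N → ℝ) (x : RN N) : ℝ :=
  ∫ y : RN N, w y * Ψ ‖y - x‖

/-- The finiteness condition `∫_{|y| > 1} w(y)^p Ψ(|y| / 2) dy < ∞` (for `w ≥ 0`), which makes
the convolution of `w^p` with `Ψ(|·|)` finite everywhere when `w` is continuous and `Ψ` is an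
admissible kernel. -/
def HasFiniteTail {N : ℕ} (Ψ : ℝ → ℝ) (p : ℝ) (w : RN N → ℝ) : Prop :=
  IntegrableOn (fun y : RN N => w y ^ p * Ψ (‖y‖ / 2)) {y : RN N | 1 < ‖y‖} volume

/-- `(u, v)` is a non-negative (classical) solution in `ℝ^N` of the system
`(-Δ)^m u ≥ (Φ(|x|) * v^{p₁}) v^{q₁}`, `(-Δ)^m v ≥ (Ψ(|x|) * u^{p₂}) u^{q₂}`. -/
structure IsNonnegSolution {N : ℕ} (m : ℕ) (Φ Ψ : ℝ → ℝ) (p₁ q₁ p₂ q₂ : ℝ)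
    (u v : RN N → ℝ) : Prop where
  contDiff_u : ContDiff ℝ ((2 * m : ℕ) : WithTop ℕ∞) u
  contDiff_v : ContDiff ℝ ((2 * m : ℕ) : WithTop ℕ∞) v
  nonneg_u : ∀ x, 0 ≤ u x
  nonneg_v : ∀ x, 0 ≤ v x
  finiteTail_v : HasFiniteTail Φ p₁ v
  finiteTail_u : HasFiniteTail Ψ p₂ u
  ineq_u : ∀ x, radialConv Φ (fun y => v y ^ p₁) x * v x ^ q₁ ≤ negLaplacianPow m u x
  ineq_v : ∀ x, radialConv Ψ (fun y => u y ^ p₂) x * u x ^ q₂ ≤ negLaplacianPow m v x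

end

/-! ### Iterated Laplacians: integration by parts and scaling. -/

section Green

variable {N : ℕ}

/-! The argument is a descending induction on `i`, starting from `i = m`, where the sign is
immediate from the system. Suppose `(-Δ)^(i+1) u ≥ 0` but `(-Δ)^i u (a) < 0`. The mean value
inequality keeps the weighted mean of `(-Δ)^i u` over every ball centred at `a` below a fixed
negative number. Moving `(-Δ)^i` onto the weight bounds the size of that mean by a multiple of
`R^(-2i)` times the mean of `u` (here `u ≥ 0` is used). Hence the means of `u` grow at least like
`R^(2i)` and tend to infinity, since `i ≥ 1` (`exists_mul_pow_le_ballMean`).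

This is impossible for either of two reasons. If `p₂ ≥ 1`, the tail condition bounds `R^N Ψ(R)`
times the mean of `u^p₂`, while `R^N Ψ(R) → ∞` (`HasFiniteTail.not_tendsto_ballMean`). If both sums
`p + q` are at least `2`, the lower bound on the kernel and Cauchy-Schwarz make the mean of each
function at radius `l R` dominate the square of the other's mean at radius `R`, with a loss
polynomial in `l - 1` (`exists_mul_sq_ballMean_le`). Iterating with dilations whose product stays
bounded makes the means unbounded on a compact interval of radii (`not_tendsto_of_superlinear`). -/

theorem laplacian_eq_sum_fderiv {f : RN N → ℝ} (hf : ContDiff ℝ 2 f) :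
    Δ f = fun x => ∑ i, fderiv ℝ (fun y => fderiv ℝ f y (EuclideanSpace.basisFun (Fin N) ℝ i)) x
      (EuclideanSpace.basisFun (Fin N) ℝ i) := by
  rw [InnerProductSpace.laplacian_eq_iteratedFDeriv_orthonormalBasis f
    (EuclideanSpace.basisFun (Fin N) ℝ)]
  funext x
  refine Finset.sum_congr rfl fun i _ => ?_
  have hd : DifferentiableAt ℝ (fderiv ℝ f) x :=
    (hf.fderiv_right (m := 1) (by norm_num)).differentiable one_ne_zero x
  rw [iteratedFDeriv_two_apply, fderiv_clm_apply hd (differentiableAt_const _)]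
  simp

theorem contDiff_fderiv_apply_const {f : RN N → ℝ} {n : ℕ}
    (hf : ContDiff ℝ ((n + 1 : ℕ) : WithTop ℕ∞) f) (v : RN N) :
    ContDiff ℝ (n : WithTop ℕ∞) (fun y => fderiv ℝ f y v) :=
  (hf.fderiv_right (m := n) (by norm_cast)).clm_apply contDiff_const

theorem contDiff_laplacian {f : RN N → ℝ} {n : ℕ}
    (hf : ContDiff ℝ ((n + 2 : ℕ) : WithTop ℕ∞) f) :
    ContDiff ℝ (n : WithTop ℕ∞) (Δ f) := by
  rw [laplacian_eq_sum_fderiv (hf.of_le (by norm_cast; omega))]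
  exact ContDiff.sum fun i _ => contDiff_fderiv_apply_const (contDiff_fderiv_apply_const hf _) _

theorem tsupport_laplacian_subset {f : RN N → ℝ} (hf : ContDiff ℝ 2 f) :
    tsupport (Δ f) ⊆ tsupport f := by
  rw [laplacian_eq_sum_fderiv hf]
  refine closure_minimal (fun x hx => ?_) (isClosed_tsupport f)
  by_contra hxs
  apply hx
  refine Finset.sum_eq_zero fun i _ => ?_
  have h0 : f =ᶠ[nhds x] fun _ => 0 := notMem_tsupport_iff_eventuallyEq.1 hxs
  have h1 : (fun y => fderiv ℝ f y (EuclideanSpace.basisFun (Fin N) ℝ i)) =ᶠ[nhds x]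
      fun _ => 0 := by
    filter_upwards [h0.fderiv (𝕜 := ℝ)] with y hy
    simp [hy]
  rw [h1.fderiv_eq]
  simp

theorem tsupport_neg_laplacian_subset {f : RN N → ℝ} (hf : ContDiff ℝ 2 f) :
    tsupport (fun x => -(Δ f x)) ⊆ tsupport f := by
  have h : Function.support (fun x => -(Δ f x)) = Function.support (Δ f) := by ext; simp
  rw [tsupport, h]
  exact tsupport_laplacian_subset hf

theorem integral_mul_fderiv_eq_neg_of_hasCompactSupport {f g : RN N → ℝ} (hf : ContDiff ℝ 1 f)
    (hg : ContDiff ℝ 1 g) (hs : HasCompactSupport g) (v : RN N) :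
    ∫ x, f x * fderiv ℝ g x v = -∫ x, fderiv ℝ f x v * g x := by
  have hg' : Continuous fun x => fderiv ℝ g x v :=
    (hg.continuous_fderiv one_ne_zero).clm_apply continuous_const
  have hf' : Continuous fun x => fderiv ℝ f x v :=
    (hf.continuous_fderiv one_ne_zero).clm_apply continuous_const
  exact integral_mul_fderiv_eq_neg_fderiv_mul_of_integrable
    ((hf'.mul hg.continuous).integrable_of_hasCompactSupport hs.mul_left)
    ((hf.continuous.mul hg').integrable_of_hasCompactSupport (hs.fderiv_apply ℝ v).mul_left)
    ((hf.continuous.mul hg.continuous).integrable_of_hasCompactSupport hs.mul_left)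
    (fun x _ => hf.differentiable one_ne_zero x)
    (fun x _ => hg.differentiable one_ne_zero x)

/-- Green's second identity against a compactly supported function. -/
theorem integral_laplacian_mul {f g : RN N → ℝ} (hf : ContDiff ℝ 2 f) (hg : ContDiff ℝ 2 g)
    (hs : HasCompactSupport g) : ∫ x, Δ f x * g x = ∫ x, f x * Δ g x := by
  have h1 : ∀ {h : RN N → ℝ}, ContDiff ℝ 2 h → ∀ v, ContDiff ℝ 1 fun y => fderiv ℝ h y v :=
    fun hh v => contDiff_fderiv_apply_const (n := 1) (by exact_mod_cast hh) v
  have h0 : ∀ {h : RN N → ℝ}, ContDiff ℝ 1 h → ∀ v, Continuous fun y => fderiv ℝ h y v :=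
    fun hh v => (hh.continuous_fderiv one_ne_zero).clm_apply continuous_const
  have hf1 : ContDiff ℝ 1 f := hf.of_le (by norm_num)
  have hg1 : ContDiff ℝ 1 g := hg.of_le (by norm_num)
  simp only [laplacian_eq_sum_fderiv hf, laplacian_eq_sum_fderiv hg, Finset.sum_mul,
    Finset.mul_sum]
  rw [integral_finsetSum, integral_finsetSum]
  · refine Finset.sum_congr rfl fun i _ => ?_
    set v := EuclideanSpace.basisFun (Fin N) ℝ i
    rw [integral_mul_fderiv_eq_neg_of_hasCompactSupport hf1 (h1 hg v) (hs.fderiv_apply ℝ v) v,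
      integral_mul_fderiv_eq_neg_of_hasCompactSupport (h1 hf v) hg1 hs v, neg_neg]
  · exact fun i _ => (hf.continuous.mul (h0 (h1 hg _) _)).integrable_of_hasCompactSupport
      ((hs.fderiv_apply ℝ _).fderiv_apply ℝ _).mul_left
  · exact fun i _ => ((h0 (h1 hf _) _).mul hg.continuous).integrable_of_hasCompactSupport
      hs.mul_left

theorem negLaplacianPow_succ (i : ℕ) (f : RN N → ℝ) :
    negLaplacianPow (i + 1) f = fun x => -(Δ (negLaplacianPow i f) x) :=
  Function.iterate_succ_apply' _ i f

theorem negLaplacianPow_succ' (i : ℕ) (f : RN N → ℝ) :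
    negLaplacianPow (i + 1) f = negLaplacianPow i (fun x => -(Δ f x)) :=
  Function.iterate_succ_apply _ i f

theorem contDiff_negLaplacianPow {n i : ℕ} {f : RN N → ℝ}
    (hf : ContDiff ℝ ((n + 2 * i : ℕ) : WithTop ℕ∞) f) :
    ContDiff ℝ (n : WithTop ℕ∞) (negLaplacianPow i f) := by
  induction i generalizing n with
  | zero => exact hf
  | succ i ih =>
    rw [negLaplacianPow_succ]
    exact (contDiff_laplacian (ih (n := n + 2) (hf.of_le (by norm_cast; omega)))).neg

theorem tsupport_negLaplacianPow_subset {i : ℕ} {f : RN N → ℝ}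
    (hf : ContDiff ℝ ((2 * i : ℕ) : WithTop ℕ∞) f) :
    tsupport (negLaplacianPow i f) ⊆ tsupport f := by
  induction i with
  | zero => exact subset_rfl
  | succ i ih =>
    rw [negLaplacianPow_succ]
    refine (tsupport_neg_laplacian_subset ?_).trans (ih (hf.of_le (by norm_cast; omega)))
    exact_mod_cast contDiff_negLaplacianPow (n := 2) (i := i) (hf.of_le (by norm_cast; omega))

theorem integral_negLaplacianPow_mul {i : ℕ} {f g : RN N → ℝ}
    (hf : ContDiff ℝ ((2 * i : ℕ) : WithTop ℕ∞) f) (hg : ContDiff ℝ ((2 * i : ℕ) : WithTop ℕ∞) g)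
    (hs : HasCompactSupport g) :
    ∫ x, negLaplacianPow i f x * g x = ∫ x, f x * negLaplacianPow i g x := by
  induction i generalizing g with
  | zero => rfl
  | succ i ih =>
    have hg2 : ContDiff ℝ 2 g := hg.of_le (by norm_cast; omega)
    have hΔ : ContDiff ℝ ((2 * i : ℕ) : WithTop ℕ∞) (Δ g) :=
      contDiff_laplacian (hg.of_le (by norm_cast))
    have hfi : ContDiff ℝ 2 (negLaplacianPow i f) := by
      exact_mod_cast contDiff_negLaplacianPow (n := 2) (i := i) (hf.of_le (by norm_cast; omega))
    rw [negLaplacianPow_succ' i g, ← ih (hf.of_le (by norm_cast; omega)) hΔ.neg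
      (hs.mono' (subset_closure.trans (tsupport_neg_laplacian_subset hg2))), negLaplacianPow_succ]
    simp only [neg_mul, mul_neg, integral_neg, integral_laplacian_mul hfi hg2 hs]

theorem laplacian_comp_affine {f : RN N → ℝ} (hf : ContDiff ℝ 2 f) (a : RN N) (R : ℝ) :
    Δ (fun y => f (a + R • y)) = fun y => R ^ 2 * Δ f (a + R • y) := by
  have h2 : ContDiff ℝ ((2 : ℕ) : WithTop ℕ∞) (fun z => f (a + z)) := by
    exact_mod_cast hf.comp (contDiff_const.add contDiff_id)
  rw [InnerProductSpace.laplacian_eq_iteratedFDeriv_stdOrthonormalBasis,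
    InnerProductSpace.laplacian_eq_iteratedFDeriv_stdOrthonormalBasis f]
  funext y
  rw [iteratedFDeriv_comp_const_smul (f := fun z => f (a + z)) R h2]
  simp [iteratedFDeriv_comp_add_left, Finset.mul_sum]

theorem negLaplacianPow_comp_affine {i : ℕ} {f : RN N → ℝ}
    (hf : ContDiff ℝ ((2 * i : ℕ) : WithTop ℕ∞) f) (a : RN N) (R : ℝ) :
    negLaplacianPow i (fun y => f (a + R • y)) =
      fun y => R ^ (2 * i) * negLaplacianPow i f (a + R • y) := by
  induction i with
  | zero => simp [negLaplacianPow]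
  | succ i ih =>
    have hfi : ContDiff ℝ 2 (negLaplacianPow i f) := by
      exact_mod_cast contDiff_negLaplacianPow (n := 2) (i := i) (hf.of_le (by norm_cast; omega))
    have hc : ContDiff ℝ 2 (fun y => negLaplacianPow i f (a + R • y)) :=
      hfi.comp (contDiff_const.add (contDiff_id.const_smul R))
    rw [negLaplacianPow_succ, ih (hf.of_le (by norm_cast; omega)), negLaplacianPow_succ]
    funext y
    have := InnerProductSpace.laplacian_smul (R ^ (2 * i)) (hc.contDiffAt (x := y))
    rw [laplacian_comp_affine hfi] at this
    change -(Δ (R ^ (2 * i) • fun y => negLaplacianPow i f (a + R • y)) y) = _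
    rw [this, smul_eq_mul]
    ring

end Green

/-! ### A radial weight of finite smoothness and the integral bound it gives. -/

section TestFunction

theorem hasDerivAt_max_zero_pow (k : ℕ) (t : ℝ) :
    HasDerivAt (fun s : ℝ => max 0 s ^ (k + 2)) ((k + 2 : ℝ) * max 0 t ^ (k + 1)) t := by
  have key : ∀ y : ℝ, y ≠ 0 →
      HasDerivAt (fun s : ℝ => max 0 s ^ (k + 2)) ((k + 2 : ℝ) * max 0 y ^ (k + 1)) y := by
    intro y hy
    rcases lt_or_gt_of_ne hy with h | h
    · have h1 : (fun s : ℝ => max 0 s ^ (k + 2)) =ᶠ[nhds y] fun _ => 0 := by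
        filter_upwards [Iio_mem_nhds h] with s hs
        simp [max_eq_left (le_of_lt (mem_Iio.1 hs))]
      simpa [max_eq_left h.le] using (hasDerivAt_const y (0 : ℝ)).congr_of_eventuallyEq h1
    · have h1 : (fun s : ℝ => max 0 s ^ (k + 2)) =ᶠ[nhds y] fun s => s ^ (k + 2) := by
        filter_upwards [Ioi_mem_nhds h] with s hs
        simp [max_eq_right (le_of_lt (mem_Ioi.1 hs))]
      simpa [max_eq_right h.le] using (hasDerivAt_pow (k + 2) y).congr_of_eventuallyEq h1
  by_cases ht : t = 0
  · subst ht
    -- At the kink the derivative is the limit of the derivatives on either side.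
    exact hasDerivAt_of_hasDerivAt_of_ne (g := fun y : ℝ => (k + 2 : ℝ) * max 0 y ^ (k + 1)) key
      (by fun_prop) (by fun_prop)
  · exact key t ht

theorem contDiff_max_zero_pow (n : ℕ) :
    ContDiff ℝ (n : WithTop ℕ∞) (fun s : ℝ => max 0 s ^ (n + 1)) := by
  induction n with
  | zero => exact contDiff_zero.2 (by fun_prop)
  | succ n ih =>
    push_cast
    rw [contDiff_succ_iff_deriv]
    refine ⟨fun t => (hasDerivAt_max_zero_pow n t).differentiableAt, by simp, ?_⟩
    rw [show deriv (fun s : ℝ => max 0 s ^ (n + 1 + 1)) =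
      fun t => (n + 2 : ℝ) * max 0 t ^ (n + 1) from
        funext fun t => (hasDerivAt_max_zero_pow n t).deriv]
    exact contDiff_const.mul ih

variable {N : ℕ}

/-- The radial test function `y ↦ (1 - |y|²)₊ᵏ`. -/
noncomputable def ballBump (N k : ℕ) (y : RN N) : ℝ := max 0 (1 - ‖y‖ ^ 2) ^ k

theorem ballBump_nonneg (k : ℕ) (y : RN N) : 0 ≤ ballBump N k y :=
  pow_nonneg (le_max_left _ _) _

theorem ballBump_eq_zero {k : ℕ} (hk : k ≠ 0) {y : RN N} (hy : y ∉ Metric.closedBall 0 1) :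
    ballBump N k y = 0 := by
  have : 1 < ‖y‖ := by simpa using hy
  rw [ballBump, max_eq_left (by nlinarith), zero_pow hk]

theorem continuous_ballBump (k : ℕ) : Continuous (ballBump N k) := by
  unfold ballBump; fun_prop

theorem hasCompactSupport_ballBump {k : ℕ} (hk : k ≠ 0) : HasCompactSupport (ballBump N k) :=
  HasCompactSupport.intro (isCompact_closedBall 0 1) fun _ hy => ballBump_eq_zero hk hy

theorem contDiff_ballBump (n : ℕ) : ContDiff ℝ (n : WithTop ℕ∞) (ballBump N (n + 1)) :=
  (contDiff_max_zero_pow n).comp (contDiff_const.sub (contDiff_norm_sq ℝ))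

/-- The gradient is a multiple of `y` times the next lower power. This is why an explicit polynomial
weight is preferred to a smooth bump: it turns radial derivatives into Laplacians. -/
theorem fderiv_ballBump (k : ℕ) (y v : RN N) :
    fderiv ℝ (ballBump N (k + 2)) y v = -(2 * (k + 2 : ℝ)) * ballBump N (k + 1) y * inner ℝ y v := by
  have h1 : HasFDerivAt (fun z : RN N => 1 - ‖z‖ ^ 2) (-(2 • innerSL ℝ y)) y :=
    (hasStrictFDerivAt_norm_sq y).hasFDerivAt.const_sub 1
  have h2 := (hasDerivAt_max_zero_pow k (1 - ‖y‖ ^ 2)).comp_hasFDerivAt y h1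
  have h3 : HasFDerivAt (ballBump N (k + 2)) _ y := h2
  rw [h3.fderiv]
  simp [ballBump]
  ring

/-- The integral of `w` over the ball `B_R(a)`, rescaled to the unit ball. -/
noncomputable def ballMean (w : RN N → ℝ) (a : RN N) (R : ℝ) : ℝ :=
  ∫ y in Metric.closedBall (0 : RN N) 1, w (a + R • y)

theorem integrableOn_comp_affine {w : RN N → ℝ} (hw : Continuous w) (a : RN N) (R r : ℝ) :
    IntegrableOn (fun y : RN N => w (a + R • y)) (Metric.closedBall 0 r) :=
  Continuous.continuousOn (by fun_prop) |>.integrableOn_compact (isCompact_closedBall 0 r)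

theorem integrable_mul_ballBump {w : RN N → ℝ} (hw : Continuous w) {k : ℕ} (hk : k ≠ 0) :
    Integrable (fun y => w y * ballBump N k y) :=
  (hw.mul (continuous_ballBump k)).integrable_of_hasCompactSupport
    (hasCompactSupport_ballBump hk).mul_left

/-- Integration by parts puts `(-Δ)^i` on the weight, where it is bounded and still supported in the
unit ball; `R ^ (2 * i)` is the scaling factor. The condition `2 * i < k` makes the weight of class
`C^(2i)`. -/
theorem exists_abs_integral_negLaplacianPow_le (N i k : ℕ) (hk : 2 * i < k) :
    ∃ C : ℝ, 0 < C ∧ ∀ (w : RN N → ℝ), ContDiff ℝ ((2 * i : ℕ) : WithTop ℕ∞) w → (∀ x, 0 ≤ w x) →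
      ∀ (a : RN N) (R : ℝ), R ^ (2 * i) *
        |∫ y, negLaplacianPow i w (a + R • y) * ballBump N k y| ≤ C * ballMean w a R := by
  obtain ⟨n, rfl⟩ : ∃ n, k = n + 1 := ⟨k - 1, by omega⟩
  have hB : ContDiff ℝ ((2 * i : ℕ) : WithTop ℕ∞) (ballBump N (n + 1)) :=
    (contDiff_ballBump n).of_le (by norm_cast; omega)
  have hS := hasCompactSupport_ballBump (N := N) n.succ_ne_zero
  have hψ : Continuous (negLaplacianPow i (ballBump N (n + 1))) :=
    (contDiff_negLaplacianPow (n := 0) (hB.of_le (by norm_cast; omega))).continuous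
  have hψs : HasCompactSupport (negLaplacianPow i (ballBump N (n + 1))) :=
    hS.mono' (subset_closure.trans (tsupport_negLaplacianPow_subset hB))
  obtain ⟨C, hC⟩ := hψs.exists_bound_of_continuous hψ
  refine ⟨max C 1, by positivity, fun w hw h0 a R => ?_⟩
  have hwR : ContDiff ℝ ((2 * i : ℕ) : WithTop ℕ∞) (fun y => w (a + R • y)) :=
    hw.comp (contDiff_const.add (contDiff_id.const_smul R))
  have hzero : ∀ y ∉ Metric.closedBall (0 : RN N) 1,
      w (a + R • y) * negLaplacianPow i (ballBump N (n + 1)) y = 0 := by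
    intro y hy
    rw [image_eq_zero_of_notMem_tsupport (f := negLaplacianPow i _), mul_zero]
    exact fun h => hy (closure_minimal (fun z (hz : ballBump N (n + 1) z ≠ 0) =>
      not_not.1 fun hz' => hz (ballBump_eq_zero n.succ_ne_zero hz')) Metric.isClosed_closedBall
        (tsupport_negLaplacianPow_subset hB h))
  have hR : R ^ (2 * i) = |R ^ (2 * i)| := by rw [abs_of_nonneg]; rw [pow_mul]; positivity
  rw [hR, ← abs_mul, ← integral_const_mul]
  simp_rw [← mul_assoc]
  have := integral_negLaplacianPow_mul hwR hB hS
  rw [negLaplacianPow_comp_affine hw] at this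
  rw [this, ← setIntegral_eq_integral_of_forall_compl_eq_zero hzero, ballMean,
    ← integral_const_mul]
  refine (abs_integral_le_integral_abs).trans (setIntegral_mono_on ?_ ?_ measurableSet_closedBall
    fun y _ => ?_)
  · exact (((hw.continuous.comp (by fun_prop : Continuous fun y : RN N => a + R • y)).mul
      hψ).continuousOn.integrableOn_compact (isCompact_closedBall 0 1)).abs
  · exact (integrableOn_comp_affine hw.continuous a R 1).const_mul _
  · rw [abs_mul, abs_of_nonneg (h0 _), mul_comm]
    exact mul_le_mul_of_nonneg_right ((hC y).trans (le_max_left _ _)) (h0 _)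

end TestFunction

/-! ### Mean value inequality and growth of means. -/

section MeanValue

variable {N : ℕ}

/-- Since `y * ballBump N (n + 1) y` is a multiple of the gradient of `ballBump N (n + 2)`, this is
one integration by parts. It gives the derivative of a weighted mean in the radius the sign of the
Laplacian. -/
theorem integral_fderiv_self_mul_ballBump {f : RN N → ℝ} (hf : ContDiff ℝ 2 f) (n : ℕ) :
    2 * (n + 2 : ℝ) * ∫ y, fderiv ℝ f y y * ballBump N (n + 1) y =
      ∫ y, Δ f y * ballBump N (n + 2) y := by
  have hf1 : ContDiff ℝ 1 f := hf.of_le (by norm_num)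
  have hB : ContDiff ℝ 1 (ballBump N (n + 2)) :=
    (contDiff_ballBump (n + 1)).of_le (by norm_cast; omega)
  have hS := hasCompactSupport_ballBump (N := N) (n + 1).succ_ne_zero
  have h1 : ∀ v, ContDiff ℝ 1 fun y => fderiv ℝ f y v :=
    fun v => contDiff_fderiv_apply_const (n := 1) (by exact_mod_cast hf) v
  set b := EuclideanSpace.basisFun (Fin N) ℝ
  have hint : ∀ i, Integrable
      (fun y => fderiv ℝ (fun z => fderiv ℝ f z (b i)) y (b i) * ballBump N (n + 2) y) :=
    fun i => integrable_mul_ballBump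
      (((h1 _).continuous_fderiv one_ne_zero).clm_apply continuous_const) (by omega)
  have hint' : ∀ i, Integrable
      (fun y => fderiv ℝ f y (b i) * fderiv ℝ (ballBump N (n + 2)) y (b i)) := fun i =>
    ((h1 _).continuous.mul ((hB.continuous_fderiv one_ne_zero).clm_apply
      continuous_const)).integrable_of_hasCompactSupport (hS.fderiv_apply ℝ _).mul_left
  have hsum : ∀ y, 2 * (n + 2 : ℝ) * (fderiv ℝ f y y * ballBump N (n + 1) y) =
      -∑ i, fderiv ℝ f y (b i) * fderiv ℝ (ballBump N (n + 2)) y (b i) := by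
    intro y
    have hy : fderiv ℝ f y y = ∑ i, inner ℝ (b i) y * fderiv ℝ f y (b i) := by
      have h := congrArg (fderiv ℝ f y) (b.sum_repr' y).symm
      rw [map_sum] at h
      simpa only [map_smul, smul_eq_mul] using h
    simp only [fderiv_ballBump, hy, Finset.mul_sum, Finset.sum_mul, ← Finset.sum_neg_distrib]
    refine Finset.sum_congr rfl fun i _ => ?_
    rw [real_inner_comm]
    ring
  rw [← integral_const_mul]
  simp only [hsum, laplacian_eq_sum_fderiv hf, Finset.sum_mul]
  rw [integral_neg, integral_finsetSum _ fun i _ => hint' i,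
    integral_finsetSum _ fun i _ => hint i, ← Finset.sum_neg_distrib]
  refine Finset.sum_congr rfl fun i _ => ?_
  rw [integral_mul_fderiv_eq_neg_of_hasCompactSupport (h1 _) hB hS, neg_neg]

theorem hasDerivAt_integral_comp_affine_mul_ballBump {w : RN N → ℝ} (hw : ContDiff ℝ 1 w)
    (a : RN N) {k : ℕ} (hk : k ≠ 0) (R : ℝ) :
    HasDerivAt (fun r : ℝ => ∫ y, w (a + r • y) * ballBump N k y)
      (∫ y, fderiv ℝ w (a + R • y) y * ballBump N k y) R := by
  have hzero : ∀ F : RN N → ℝ, ∀ y ∉ Metric.closedBall (0 : RN N) 1, F y * ballBump N k y = 0 :=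
    fun F y hy => by rw [ballBump_eq_zero hk hy, mul_zero]
  have hconv : ∀ F : RN N → ℝ, ∫ y, F y * ballBump N k y =
      ∫ y in Metric.closedBall (0 : RN N) 1, F y * ballBump N k y := fun F =>
    (setIntegral_eq_integral_of_forall_compl_eq_zero (hzero F)).symm
  simp only [hconv]
  have hB := continuous_ballBump (N := N) k
  have hD : Continuous fun p : ℝ × RN N =>
      fderiv ℝ w (a + p.1 • p.2) p.2 * ballBump N k p.2 :=
    (((hw.continuous_fderiv one_ne_zero).comp (by fun_prop : Continuous fun p : ℝ × RN N =>
      a + p.1 • p.2)).clm_apply continuous_snd).mul (hB.comp continuous_snd)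
  obtain ⟨C, hC⟩ := ((isCompact_closedBall R 1).prod
    (isCompact_closedBall (0 : RN N) 1)).exists_bound_of_continuousOn hD.continuousOn
  have hF : ∀ r : ℝ, Continuous fun y => w (a + r • y) * ballBump N k y := fun r =>
    (hw.continuous.comp (by fun_prop)).mul hB
  refine (hasDerivAt_integral_of_dominated_loc_of_deriv_le (bound := fun _ => C)
    (F := fun r y => w (a + r • y) * ballBump N k y)
    (F' := fun r y => fderiv ℝ w (a + r • y) y * ballBump N k y)
    (Metric.closedBall_mem_nhds R one_pos) ?_ ?_ ?_ ?_ ?_ ?_).2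
  · exact Eventually.of_forall fun r => (hF r).aestronglyMeasurable
  · exact (hF R).continuousOn.integrableOn_compact (isCompact_closedBall 0 1)
  · exact (hD.comp (by fun_prop : Continuous fun y : RN N => (R, y))).aestronglyMeasurable
  · filter_upwards [ae_restrict_mem measurableSet_closedBall] with y hy r hr
    exact hC (r, y) ⟨hr, hy⟩
  · exact (integrableOn_const (isCompact_closedBall _ _).measure_lt_top.ne)
  · refine Eventually.of_forall fun y r _ => ?_
    have h1 : HasDerivAt (fun s : ℝ => a + s • y) y r := by
      simpa using ((hasDerivAt_id r).smul_const y).const_add a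
    exact ((hw.differentiable one_ne_zero _).hasFDerivAt.comp_hasDerivAt r h1).mul_const _

/-- The mean value inequality for superharmonic functions. -/
theorem integral_mul_ballBump_le_of_laplacian_nonpos {w : RN N → ℝ} (hw : ContDiff ℝ 2 w)
    (hΔ : ∀ x, Δ w x ≤ 0) (a : RN N) (n : ℕ) {R : ℝ} (hR : 0 ≤ R) :
    ∫ y, w (a + R • y) * ballBump N (n + 1) y ≤ w a * ∫ y, ballBump N (n + 1) y := by
  have hd := hasDerivAt_integral_comp_affine_mul_ballBump (hw.of_le (by norm_num)) a n.succ_ne_zero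
  have hanti : AntitoneOn (fun r : ℝ => ∫ y, w (a + r • y) * ballBump N (n + 1) y) (Ici 0) := by
    refine antitoneOn_of_deriv_nonpos (convex_Ici 0)
      (fun r _ => (hd r).continuousAt.continuousWithinAt)
      (fun r _ => (hd r).differentiableAt.differentiableWithinAt) fun r hr => ?_
    rw [interior_Ici] at hr
    have hr0 : 0 < r := hr
    rw [(hd r).deriv]
    have hW : ContDiff ℝ 2 fun y => w (a + r • y) :=
      hw.comp (contDiff_const.add (contDiff_id.const_smul r))
    have h1 := integral_fderiv_self_mul_ballBump hW n
    have h2 : ∀ y, fderiv ℝ (fun z => w (a + r • z)) y y = r * fderiv ℝ w (a + r • y) y := by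
      intro y
      have h3 : HasFDerivAt (fun z : RN N => a + r • z) (r • ContinuousLinearMap.id ℝ (RN N)) y :=
        ((hasFDerivAt_id y).const_smul r).const_add a
      have h4 := ((hw.differentiable two_ne_zero (a + r • y)).hasFDerivAt.comp y h3).fderiv
      change fderiv ℝ (w ∘ fun z : RN N => a + r • z) y y = _
      rw [h4]
      simp
    simp only [h2, mul_assoc] at h1
    rw [integral_const_mul] at h1
    have h5 : ∫ y, Δ (fun z => w (a + r • z)) y * ballBump N (n + 2) y ≤ 0 := by
      rw [laplacian_comp_affine hw]
      exact integral_nonpos fun y => mul_nonpos_of_nonpos_of_nonneg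
        (mul_nonpos_of_nonneg_of_nonpos (sq_nonneg r) (hΔ _)) (ballBump_nonneg _ _)
    rw [← h1] at h5
    by_contra! hcon
    have : 0 < 2 * ((n + 2 : ℝ) * (r * ∫ y, fderiv ℝ w (a + r • y) y * ballBump N (n + 1) y)) := by
      positivity
    linarith
  -- At radius `0` the weighted mean is `w a` times the mass of the weight.
  have := hanti self_mem_Ici hR hR
  simpa [integral_const_mul] using this

theorem integral_ballBump_pos {k : ℕ} (hk : k ≠ 0) : 0 < ∫ y, ballBump N k y := by
  refine (continuous_ballBump k).integral_pos_of_hasCompactSupport_nonneg_nonzero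
    (hasCompactSupport_ballBump hk) (ballBump_nonneg k) (x := 0) ?_
  simp [ballBump]

/-- If `(-Δ)^i w` is superharmonic and negative somewhere, the means of `w ≥ 0` grow at least like
`R^{2i}`. -/
theorem exists_mul_pow_le_ballMean {w : RN N → ℝ} {i : ℕ}
    (hw : ContDiff ℝ ((2 * (i + 1) : ℕ) : WithTop ℕ∞) w) (h0 : ∀ x, 0 ≤ w x)
    (hsucc : ∀ x, 0 ≤ negLaplacianPow (i + 1) w x) {a : RN N} (ha : negLaplacianPow i w a < 0) :
    ∃ c : ℝ, 0 < c ∧ ∀ R : ℝ, 0 ≤ R → c * R ^ (2 * i) ≤ ballMean w a R := by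
  obtain ⟨C, hC0, hC⟩ := exists_abs_integral_negLaplacianPow_le N i (2 * i + 1) (by omega)
  have hB := integral_ballBump_pos (N := N) (2 * i).succ_ne_zero
  refine ⟨-negLaplacianPow i w a * (∫ y, ballBump N (2 * i + 1) y) / C,
    div_pos (mul_pos (neg_pos.2 ha) hB) hC0, fun R hR => ?_⟩
  have hwi : ContDiff ℝ 2 (negLaplacianPow i w) := by
    exact_mod_cast contDiff_negLaplacianPow (n := 2) (i := i) (hw.of_le (by norm_cast; omega))
  have h1 := integral_mul_ballBump_le_of_laplacian_nonpos hwi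
    (fun x => by have := hsucc x; rw [negLaplacianPow_succ] at this; linarith) a (2 * i) hR
  have h2 := hC w (hw.of_le (by norm_cast; omega)) h0 a R
  rw [div_mul_eq_mul_div, div_le_iff₀ hC0, mul_comm _ C]
  refine le_trans ?_ h2
  rw [mul_comm]
  gcongr
  rw [neg_mul]
  exact (neg_le_neg h1).trans (neg_le_abs _)

end MeanValue

/-! ### Kernel estimates and means of powers. -/

section Convolution

variable {N : ℕ}

/-- Lets the unconstrained value of the kernel profile at `0` be ignored. -/
theorem ae_ne_of_one_le (hN : 1 ≤ N) (x : RN N) : ∀ᵐ y : RN N, y ≠ x := by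
  have : Nonempty (Fin N) := ⟨⟨0, hN⟩⟩
  exact ae_iff.2 (by simp)

theorem IsAdmissibleKernel.locallyIntegrable_comp_sub {Ψ : ℝ → ℝ} (hΨ : IsAdmissibleKernel N Ψ)
    (x : RN N) : LocallyIntegrable (fun y : RN N => Ψ ‖y - x‖) := by
  rw [locallyIntegrable_iff]
  intro K hK
  have h1 : IntegrableOn (fun x : RN N => Ψ ‖x‖) ((fun y => y - x) '' K) :=
    hΨ.locallyIntegrable.integrableOn_isCompact (hK.image (by fun_prop))
  have h2 := (measurePreserving_sub_right (volume : Measure (RN N)) x).integrableOn_comp_preimage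
    (MeasurableEquiv.subRight x).measurableEmbedding (f := fun z : RN N => Ψ ‖z‖)
    (s := (fun y => y - x) '' K)
  exact (h2.2 h1).mono_set (subset_preimage_image _ _)

/-- The integrand of the convolution is integrable. -/
theorem integrable_rpow_mul_kernel {Ψ : ℝ → ℝ} (hΨ : IsAdmissibleKernel N Ψ) {p : ℝ}
    (hp : 0 < p) {w : RN N → ℝ} (hw : Continuous w) (h0 : ∀ x, 0 ≤ w x)
    (ht : HasFiniteTail Ψ p w) (x : RN N) :
    Integrable (fun y => w y ^ p * Ψ ‖y - x‖) := by
  have hwp : Continuous fun y => w y ^ p := hw.rpow_const fun _ => Or.inr hp.le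
  have hloc : LocallyIntegrable (fun y : RN N => w y ^ p * Ψ ‖y - x‖) := by
    rw [locallyIntegrable_iff]
    intro K hK
    exact ((hΨ.locallyIntegrable_comp_sub x).integrableOn_isCompact hK).continuousOn_mul
      hwp.continuousOn hK
  -- Outside this ball both `1 < ‖y‖` and `‖y‖ / 2 ≤ ‖y - x‖` hold, so the tail condition dominates.
  set r := 1 + 2 * ‖x‖
  have hin : IntegrableOn (fun y : RN N => w y ^ p * Ψ ‖y - x‖) (Metric.closedBall 0 r) :=
    hloc.integrableOn_isCompact (isCompact_closedBall 0 r)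
  have hout : IntegrableOn (fun y : RN N => w y ^ p * Ψ ‖y - x‖) (Metric.closedBall 0 r)ᶜ := by
    have hsub : (Metric.closedBall (0 : RN N) r)ᶜ ⊆ {y | 1 < ‖y‖} := by
      intro y hy
      have : r < ‖y‖ := by simpa using hy
      have hx := norm_nonneg x
      simp only [mem_ofPred_eq]
      linarith
    refine (ht.mono_set hsub).mono' hloc.aestronglyMeasurable.restrict ?_
    filter_upwards [ae_restrict_mem measurableSet_closedBall.compl] with y hy
    have hy' : 1 + 2 * ‖x‖ < ‖y‖ := by simpa using hy
    have hx := norm_nonneg x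
    have h1 : ‖y‖ - ‖x‖ ≤ ‖y - x‖ := norm_sub_norm_le y x
    have h2 : 0 < ‖y‖ / 2 := by linarith
    have h3 : ‖y‖ / 2 ≤ ‖y - x‖ := by linarith
    rw [Real.norm_of_nonneg (mul_nonneg (Real.rpow_nonneg (h0 y) p)
      (hΨ.pos _ (h2.trans_le h3)).le)]
    exact mul_le_mul_of_nonneg_left (hΨ.antitoneOn h2 (h2.trans_le h3) h3)
      (Real.rpow_nonneg (h0 y) p)
  rw [← integrableOn_univ, ← union_compl_self (Metric.closedBall (0 : RN N) r)]
  exact hin.union hout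

theorem rpow_mul_kernel_nonneg_ae (hN : 1 ≤ N) {Ψ : ℝ → ℝ} (hΨ : IsAdmissibleKernel N Ψ) (p : ℝ)
    {w : RN N → ℝ} (h0 : ∀ x, 0 ≤ w x) (x : RN N) :
    ∀ᵐ y : RN N, 0 ≤ w y ^ p * Ψ ‖y - x‖ := by
  filter_upwards [ae_ne_of_one_le hN x] with y hy
  exact mul_nonneg (Real.rpow_nonneg (h0 y) p) (hΨ.pos _ (norm_pos_iff.2 (sub_ne_zero.2 hy))).le

theorem radialConv_nonneg (hN : 1 ≤ N) {Ψ : ℝ → ℝ} (hΨ : IsAdmissibleKernel N Ψ) (p : ℝ)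
    {w : RN N → ℝ} (h0 : ∀ x, 0 ≤ w x) (x : RN N) : 0 ≤ radialConv Ψ (fun y => w y ^ p) x :=
  integral_nonneg_of_ae (rpow_mul_kernel_nonneg_ae hN hΨ p h0 x)

theorem setIntegral_closedBall_eq (w : RN N → ℝ) (a : RN N) {R : ℝ} (hR : 0 < R) :
    ∫ y in Metric.closedBall a R, w y = R ^ N * ballMean w a R := by
  have h1 : ∫ y in Metric.closedBall a R, w y =
      ∫ z in Metric.closedBall (0 : RN N) R, w (a + z) := by
    have := (measurePreserving_add_left (volume : Measure (RN N)) a).setIntegral_preimage_emb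
      (MeasurableEquiv.addLeft a).measurableEmbedding w (Metric.closedBall a R)
    rw [← this]
    congr 2
    ext z
    simp
  have h2 := Measure.setIntegral_comp_smul_of_pos (volume : Measure (RN N)) (fun z => w (a + z))
    (Metric.closedBall (0 : RN N) 1) hR
  rw [smul_unitClosedBall_of_nonneg hR.le, finrank_euclideanSpace_fin, smul_eq_mul, ← h1] at h2
  rw [ballMean, h2, mul_inv_cancel_left₀ (pow_pos hR N).ne']

/-- Two points of a ball of radius `R` are at most `2 * R` apart, so by monotonicity the kernel is
at least `Ψ (2 * R)` almost everywhere on the ball. -/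
theorem radialConv_ge (hN : 1 ≤ N) {Ψ : ℝ → ℝ} (hΨ : IsAdmissibleKernel N Ψ) {p : ℝ}
    (hp : 0 < p) {w : RN N → ℝ} (hw : Continuous w) (h0 : ∀ x, 0 ≤ w x)
    (ht : HasFiniteTail Ψ p w) {a x : RN N} {R : ℝ} (hR : 0 < R) (hx : x ∈ Metric.closedBall a R) :
    R ^ N * Ψ (2 * R) * ballMean (fun y => w y ^ p) a R ≤ radialConv Ψ (fun y => w y ^ p) x := by
  have hint := integrable_rpow_mul_kernel hΨ hp hw h0 ht x
  have hwp : Continuous fun y => w y ^ p := hw.rpow_const fun _ => Or.inr hp.le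
  calc R ^ N * Ψ (2 * R) * ballMean (fun y => w y ^ p) a R
      = ∫ y in Metric.closedBall a R, w y ^ p * Ψ (2 * R) := by
        rw [integral_mul_const, setIntegral_closedBall_eq (fun y => w y ^ p) a hR]
        ring
    _ ≤ ∫ y in Metric.closedBall a R, w y ^ p * Ψ ‖y - x‖ := by
        refine setIntegral_mono_on_ae ((hwp.mul continuous_const).continuousOn.integrableOn_compact
          (isCompact_closedBall a R)) hint.integrableOn measurableSet_closedBall ?_
        filter_upwards [ae_ne_of_one_le hN x] with y hy hyR
        have h1 : 0 < ‖y - x‖ := norm_pos_iff.2 (sub_ne_zero.2 hy)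
        have h2 : ‖y - x‖ ≤ 2 * R := by
          rw [← dist_eq_norm]
          have := dist_triangle_right y x a
          have := Metric.mem_closedBall.1 hyR
          have := Metric.mem_closedBall.1 hx
          linarith
        exact mul_le_mul_of_nonneg_left (hΨ.antitoneOn h1 (h1.trans_le h2) h2)
          (Real.rpow_nonneg (h0 y) p)
    _ ≤ radialConv Ψ (fun y => w y ^ p) x :=
        setIntegral_le_integral hint (rpow_mul_kernel_nonneg_ae hN hΨ p h0 x)

theorem ballMean_mono_of_continuous {f g : RN N → ℝ} (hf : Continuous f) (hg : Continuous g)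
    (hfg : ∀ x, f x ≤ g x) (a : RN N) (R : ℝ) : ballMean f a R ≤ ballMean g a R :=
  setIntegral_mono (integrableOn_comp_affine hf a R 1) (integrableOn_comp_affine hg a R 1)
    fun _ => hfg _

/-- The pointwise bound `t - 1 ≤ t ^ p` replaces Jensen's inequality; the additive loss is harmless
for means tending to infinity. -/
theorem ballMean_sub_volume_le_ballMean_rpow {w : RN N → ℝ} (hw : Continuous w)
    (h0 : ∀ x, 0 ≤ w x) {p : ℝ} (hp : 1 ≤ p) (a : RN N) (R : ℝ) :
    ballMean w a R - volume.real (Metric.closedBall (0 : RN N) 1) ≤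
      ballMean (fun y => w y ^ p) a R := by
  have hwp : Continuous fun y => w y ^ p := hw.rpow_const fun _ => Or.inr (by linarith)
  have h1 : ballMean (fun y => w y - 1) a R =
      ballMean w a R - volume.real (Metric.closedBall (0 : RN N) 1) := by
    unfold ballMean
    rw [integral_sub (integrableOn_comp_affine hw a R 1)
      (integrableOn_const (isCompact_closedBall _ _).measure_lt_top.ne)]
    simp
  rw [← h1]
  refine ballMean_mono_of_continuous (hw.sub continuous_const) hwp (fun x => ?_) a R
  change w x - 1 ≤ w x ^ p
  rcases le_total 1 (w x) with h | h
  · have := Real.rpow_le_rpow_of_exponent_le h hp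
    rw [Real.rpow_one] at this
    linarith
  · have := Real.rpow_nonneg (h0 x) p
    linarith

/-- Cauchy-Schwarz for means of powers. -/
theorem sq_ballMean_rpow_le {w : RN N → ℝ} (hw : Continuous w) (h0 : ∀ x, 0 ≤ w x) {p q : ℝ}
    (hp : 0 < p) (hq : 0 < q) (a : RN N) (R : ℝ) :
    ballMean (fun y => w y ^ ((p + q) / 2)) a R ^ 2 ≤
      ballMean (fun y => w y ^ p) a R * ballMean (fun y => w y ^ q) a R := by
  have hc : ∀ s : ℝ, 0 < s → Continuous fun y => w (a + R • y) ^ s := fun s hs =>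
    (hw.comp (by fun_prop : Continuous fun y => a + R • y)).rpow_const fun _ => Or.inr hs.le
  have hm : ∀ s : ℝ, 0 < s → MemLp (fun y => w (a + R • y) ^ (s / 2)) (ENNReal.ofReal 2)
      (volume.restrict (Metric.closedBall (0 : RN N) 1)) := by
    intro s hs
    rw [show ENNReal.ofReal 2 = 2 by simp, memLp_two_iff_integrable_sq
      (hc _ (half_pos hs)).aestronglyMeasurable]
    exact ((hc _ (half_pos hs)).pow 2).continuousOn.integrableOn_compact (isCompact_closedBall 0 1)
  have h := integral_mul_le_Lp_mul_Lq_of_nonneg (p := 2) (q := 2) (by constructor <;> norm_num)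
    (Eventually.of_forall fun y => Real.rpow_nonneg (h0 (a + R • y)) (p / 2))
    (Eventually.of_forall fun y => Real.rpow_nonneg (h0 (a + R • y)) (q / 2)) (hm p hp) (hm q hq)
  have e1 : ∀ y, w (a + R • y) ^ (p / 2) * w (a + R • y) ^ (q / 2) =
      w (a + R • y) ^ ((p + q) / 2) := fun y => by
    rw [← Real.rpow_add_of_nonneg (h0 _) (by positivity) (by positivity), add_div]
  have e2 : ∀ (s : ℝ) y, (w (a + R • y) ^ (s / 2)) ^ (2 : ℝ) = w (a + R • y) ^ s := fun s y => by
    rw [← Real.rpow_mul (h0 _), div_mul_cancel₀ _ two_ne_zero]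
  simp only [e1, e2, ← Real.sqrt_eq_rpow] at h
  have hnn : ∀ s : ℝ, 0 ≤ ballMean (fun y => w y ^ s) a R := fun s =>
    integral_nonneg fun y => Real.rpow_nonneg (h0 _) _
  calc _ ≤ (√(ballMean (fun y => w y ^ p) a R) * √(ballMean (fun y => w y ^ q) a R)) ^ 2 :=
        pow_le_pow_left₀ (hnn _) h 2
    _ = _ := by rw [mul_pow, Real.sq_sqrt (hnn _), Real.sq_sqrt (hnn _)]

end Convolution

/-! ### Contradictions from means tending to infinity, and the conclusion. -/

section Growth

variable {N : ℕ}

/-- The means of a function with finite tail do not tend to infinity when `1 ≤ p`. -/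
theorem HasFiniteTail.not_tendsto_ballMean {Ψ : ℝ → ℝ}
    (hΨ : IsAdmissibleKernel N Ψ) {p : ℝ} (hp : 1 ≤ p) {w : RN N → ℝ} (hw : Continuous w)
    (h0 : ∀ x, 0 ≤ w x) (ht : HasFiniteTail Ψ p w) (a : RN N) :
    ¬ Tendsto (ballMean w a) atTop atTop := by
  intro hJ
  have hwp : Continuous fun y => w y ^ p := hw.rpow_const fun _ => Or.inr (by linarith)
  have hnn : ∀ y, 0 ≤ w y ^ p := fun y => Real.rpow_nonneg (h0 y) p
  have hloc : ∀ (b : RN N) r, IntegrableOn (fun y => w y ^ p) (Metric.closedBall b r) :=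
    fun b r => hwp.continuousOn.integrableOn_compact (isCompact_closedBall b r)
  set T := ∫ y in {y : RN N | 1 < ‖y‖}, w y ^ p * Ψ (‖y‖ / 2)
  set C := ∫ y in Metric.closedBall (0 : RN N) 1, w y ^ p
  have hC : 0 ≤ C := integral_nonneg hnn
  have hm : MeasurableSet {y : RN N | 1 < ‖y‖} := measurableSet_lt measurable_const measurable_norm
  -- The ball of radius `R` about `a` lies in `‖y‖ ≤ 2 * R`, where `Ψ R ≤ Ψ (‖y‖ / 2)` as soon as `1
  -- < ‖y‖`; the remaining unit ball contributes at most `C * Ψ 1`.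
  have hbound : ∀ R : ℝ, 1 ≤ R → ‖a‖ ≤ R →
      R ^ N * Ψ R * ballMean (fun y => w y ^ p) a R ≤ T + C * Ψ 1 := by
    intro R hR haR
    have hR0 : 0 < R := by linarith
    have hΨR := hΨ.pos R hR0
    have e1 : R ^ N * Ψ R * ballMean (fun y => w y ^ p) a R =
        (∫ y in Metric.closedBall a R, w y ^ p) * Ψ R := by
      rw [setIntegral_closedBall_eq (fun y => w y ^ p) a hR0]
      ring
    rw [e1, ← integral_inter_add_sdiff (s := Metric.closedBall a R) hm (hloc a R), add_mul]
    refine add_le_add ?_ ?_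
    · rw [← integral_mul_const]
      refine (setIntegral_mono_on (((hloc a R).mono_set inter_subset_left).mul_const _)
        (ht.mono_set inter_subset_right) (measurableSet_closedBall.inter hm) ?_).trans ?_
      · rintro y ⟨hyR, hy⟩
        have hy1 : 1 < ‖y‖ := hy
        have h1 : ‖y‖ ≤ 2 * R := by
          have := norm_le_norm_add_norm_sub' y a
          have := mem_closedBall_iff_norm.1 hyR
          linarith
        exact mul_le_mul_of_nonneg_left (hΨ.antitoneOn (by simp only [mem_Ioi]; linarith)
          (mem_Ioi.2 hR0) (by linarith)) (hnn y)
      · refine setIntegral_mono_set ht ?_ inter_subset_right.eventuallyLE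
        filter_upwards [ae_restrict_mem hm] with y hy
        have hy1 : 1 < ‖y‖ := hy
        exact mul_nonneg (hnn y) (hΨ.pos _ (by linarith)).le
    · refine mul_le_mul ?_ (hΨ.antitoneOn (mem_Ioi.2 one_pos) (mem_Ioi.2 hR0) hR) hΨR.le hC
      refine setIntegral_mono_set (hloc 0 1) (Eventually.of_forall hnn)
        (LE.le.eventuallyLE fun y hy => ?_)
      have : ¬ 1 < ‖y‖ := hy.2
      simpa using not_lt.1 this
  obtain ⟨R, h1, h2, h3, h4⟩ := ((eventually_ge_atTop 1).and ((eventually_ge_atTop ‖a‖).and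
    ((hΨ.tendsto.eventually_ge_atTop 1).and (hJ.eventually_ge_atTop (|T + C * Ψ 1| + 1 +
      volume.real (Metric.closedBall (0 : RN N) 1)))))).exists
  have h5 := ballMean_sub_volume_le_ballMean_rpow hw h0 hp a R
  have h6 := hbound R h1 h2
  have h7 := le_abs_self (T + C * Ψ 1)
  have h8 : |T + C * Ψ 1| + 1 ≤ ballMean (fun y => w y ^ p) a R := by linarith
  have h9 := abs_nonneg (T + C * Ψ 1)
  nlinarith [mul_le_mul_of_nonneg_right h3 (h9.trans (by linarith :
    |T + C * Ψ 1| ≤ ballMean (fun y => w y ^ p) a R))]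

/-- On the ball of radius `l⁻¹` the base of the weight satisfies `1 - ‖y‖ ^ 2 ≥ 1 - l⁻¹ ≥ (l - 1) /
2`, and rescaling that ball costs `l ^ N ≤ 2 ^ N`. -/
theorem ballMean_mul_inv_le_integral_mul_ballBump {f : RN N → ℝ} (hf : Continuous f)
    (h0 : ∀ x, 0 ≤ f x) (a : RN N) {k : ℕ} (hk : k ≠ 0) {R l : ℝ} (hl : 1 < l)
    (hl2 : l ≤ 2) :
    ((l - 1) / 2) ^ k * ((2 ^ N)⁻¹ * ballMean f a R) ≤
      ∫ y, f (a + (l * R) • y) * ballBump N k y := by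
  have hl0 : 0 < l := by linarith
  have hfc : Continuous fun y : RN N => f (a + (l * R) • y) := hf.comp (by fun_prop)
  have hint := integrable_mul_ballBump hfc hk
  have hJ : 0 ≤ ballMean f a R := integral_nonneg fun _ => h0 _
  have hscale : ∫ y in Metric.closedBall (0 : RN N) l⁻¹, f (a + (l * R) • y) =
      (l ^ N)⁻¹ * ballMean f a R := by
    have := Measure.setIntegral_comp_smul_of_pos (volume : Measure (RN N))
      (fun y => f (a + R • y)) (Metric.closedBall (0 : RN N) l⁻¹) hl0
    rw [smul_closedBall _ _ (inv_pos.2 hl0).le, smul_zero, Real.norm_of_nonneg hl0.le,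
      mul_inv_cancel₀ hl0.ne', finrank_euclideanSpace_fin, smul_eq_mul] at this
    rw [ballMean, ← this]
    simp only [smul_smul, mul_comm R]
  calc ((l - 1) / 2) ^ k * ((2 ^ N)⁻¹ * ballMean f a R)
      ≤ ((l - 1) / 2) ^ k * ((l ^ N)⁻¹ * ballMean f a R) := by
        have : 0 ≤ (l - 1) / 2 := by linarith
        gcongr
    _ = ∫ y in Metric.closedBall (0 : RN N) l⁻¹, f (a + (l * R) • y) * ((l - 1) / 2) ^ k := by
        rw [integral_mul_const, hscale]
        ring
    _ ≤ ∫ y in Metric.closedBall (0 : RN N) l⁻¹, f (a + (l * R) • y) * ballBump N k y := by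
        refine setIntegral_mono_on ((hfc.mul continuous_const).continuousOn.integrableOn_compact
          (isCompact_closedBall _ _)) hint.integrableOn measurableSet_closedBall fun y hy => ?_
        refine mul_le_mul_of_nonneg_left (pow_le_pow_left₀ (by linarith) ?_ k) (h0 _)
        have hy1 : ‖y‖ ≤ l⁻¹ := by simpa using hy
        have hy2 : ‖y‖ * l ≤ 1 := by rwa [← le_div_iff₀ hl0, one_div]
        have hy0 := norm_nonneg y
        have hyn : ‖y‖ ≤ 1 := hy1.trans (inv_le_one_of_one_le₀ hl.le)
        refine le_max_of_le_right ?_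
        nlinarith
    _ ≤ _ := setIntegral_le_integral hint
        (Eventually.of_forall fun y => mul_nonneg (h0 _) (ballBump_nonneg k y))

/-- The nonlocal inequality makes the means of `v` at radius `l R` dominate the squared means of `u`
at radius `R`. -/
theorem exists_mul_sq_ballMean_le (hN : 1 ≤ N) {m : ℕ} {Ψ : ℝ → ℝ}
    (hΨ : IsAdmissibleKernel N Ψ) {p q : ℝ} (hp : 0 < p) (hq : 0 < q) (hpq : 2 ≤ p + q)
    {u v : RN N → ℝ} (hu : Continuous u) (hu0 : ∀ x, 0 ≤ u x) (ht : HasFiniteTail Ψ p u)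
    (hv : ContDiff ℝ ((2 * m : ℕ) : WithTop ℕ∞) v) (hv0 : ∀ x, 0 ≤ v x)
    (hineq : ∀ x, radialConv Ψ (fun y => u y ^ p) x * u x ^ q ≤ negLaplacianPow m v x)
    (a : RN N) (hJ : Tendsto (ballMean u a) atTop atTop) :
    ∃ c : ℝ, 0 < c ∧ ∀ᶠ R in atTop, ∀ l : ℝ, 1 < l → l ≤ 2 →
      c * (l - 1) ^ (2 * m + 1) * ballMean u a R ^ 2 ≤ ballMean v a (l * R) := by
  obtain ⟨C, hC0, hC⟩ := exists_abs_integral_negLaplacianPow_le N m (2 * m + 1) (by omega)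
  -- The first two factors come from comparing the weight with the indicator of the smaller ball.
  -- The factor `4⁻¹` is the square of the half of the mean that survives subtracting the volume of
  -- the unit ball, and `C` comes from integrating by parts.
  refine ⟨((2 : ℝ) ^ (2 * m + 1))⁻¹ * (2 ^ N)⁻¹ * 4⁻¹ / C, by positivity, ?_⟩
  have hL : Tendsto (fun R : ℝ => (2 * R) ^ N * Ψ (2 * R)) atTop atTop :=
    hΨ.tendsto.comp (tendsto_id.const_mul_atTop two_pos)
  filter_upwards [eventually_ge_atTop 1, hL.eventually_ge_atTop (2 ^ N),
    hJ.eventually_ge_atTop (2 * volume.real (Metric.closedBall (0 : RN N) 1))]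
    with R hR1 hLR hJR l hl hl2
  have hR0 : 0 < R := by linarith
  have hvm : Continuous (negLaplacianPow m v) :=
    (contDiff_negLaplacianPow (n := 0) (hv.of_le (by norm_cast; omega))).continuous
  have huq : Continuous fun y => u y ^ q := hu.rpow_const fun _ => Or.inr hq.le
  have hvm0 : ∀ x, 0 ≤ negLaplacianPow m v x := fun x =>
    (mul_nonneg (radialConv_nonneg hN hΨ p hu0 x) (Real.rpow_nonneg (hu0 x) q)).trans (hineq x)
  have hPp : 0 ≤ ballMean (fun y => u y ^ p) a R :=
    integral_nonneg fun _ => Real.rpow_nonneg (hu0 _) _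
  have hL1 : 1 ≤ R ^ N * Ψ (2 * R) := by
    rw [mul_pow, mul_assoc] at hLR
    exact le_of_mul_le_mul_left (by rwa [mul_one]) (pow_pos two_pos N)
  have h1 : ballMean (fun y => u y ^ p) a R * ballMean (fun y => u y ^ q) a R ≤
      ballMean (negLaplacianPow m v) a R := by
    unfold ballMean at hPp ⊢
    rw [← integral_const_mul]
    refine setIntegral_mono_on ((integrableOn_comp_affine huq a R 1).const_mul _)
      (integrableOn_comp_affine hvm a R 1) measurableSet_closedBall fun y hy => ?_
    refine le_trans (mul_le_mul_of_nonneg_right ?_ (Real.rpow_nonneg (hu0 _) q)) (hineq _)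
    refine le_trans ?_ (radialConv_ge hN hΨ hp hu hu0 ht (a := a) hR0 ?_)
    · exact le_mul_of_one_le_left hPp hL1
    · rw [mem_closedBall_iff_norm, add_sub_cancel_left, norm_smul, Real.norm_of_nonneg hR0.le]
      exact mul_le_of_le_one_right hR0.le (by simpa using hy)
  have h2 := sq_ballMean_rpow_le hu hu0 hp hq a R
  have h3 := ballMean_sub_volume_le_ballMean_rpow hu hu0 (p := (p + q) / 2) (by linarith) a R
  have hJ0 : 0 ≤ ballMean u a R := integral_nonneg fun _ => hu0 _
  have h4 : 4⁻¹ * ballMean u a R ^ 2 ≤ ballMean (negLaplacianPow m v) a R := by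
    have : (ballMean u a R / 2) ^ 2 ≤ ballMean (fun y => u y ^ ((p + q) / 2)) a R ^ 2 :=
      pow_le_pow_left₀ (by positivity) (by linarith) 2
    linarith [h2, h1, this, (by ring : (ballMean u a R / 2) ^ 2 = 4⁻¹ * ballMean u a R ^ 2)]
  have h5 := ballMean_mul_inv_le_integral_mul_ballBump hvm hvm0 a
    (2 * m).succ_ne_zero (R := R) hl hl2
  have h6 := hC v hv hv0 a (l * R)
  have hlR : 1 ≤ l * R := by nlinarith
  -- The gain `(l * R) ^ (2 * m) ≥ 1` is discarded.
  have h7 : ∫ y, negLaplacianPow m v (a + (l * R) • y) * ballBump N (2 * m + 1) y ≤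
      C * ballMean v a (l * R) :=
    (le_abs_self _).trans ((le_mul_of_one_le_left (abs_nonneg _) (one_le_pow₀ hlR)).trans h6)
  have hl1 : 0 < l - 1 := by linarith
  rw [div_mul_eq_mul_div, div_mul_eq_mul_div, div_le_iff₀ hC0, mul_comm _ C]
  refine le_trans (le_of_eq_of_le ?_ (mul_le_mul_of_nonneg_left (mul_le_mul_of_nonneg_left h4
    (inv_nonneg.2 (pow_nonneg two_pos.le N))) (pow_nonneg (half_pos hl1).le _))) (h5.trans h7)
  rw [Nat.succ_eq_add_one, div_pow]
  ring

theorem continuous_ballMean {w : RN N → ℝ} (hw : Continuous w) (a : RN N) :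
    Continuous (ballMean w a) :=
  continuous_parametric_integral_of_continuous (f := fun (R : ℝ) (y : RN N) => w (a + R • y))
    (hw.comp (by fun_prop : Continuous fun p : ℝ × RN N => a + p.1 • p.2))
    (isCompact_closedBall 0 1)

/-- Superlinear growth under arbitrarily small dilations forces blow-up at a finite radius. -/
theorem not_tendsto_of_superlinear {H : ℝ → ℝ} (hH : Continuous H) {c : ℝ} (hc : 0 < c) (P : ℕ)
    (hstep : ∀ᶠ R in atTop, ∀ l : ℝ, 1 < l → l ≤ 2 → c * (l - 1) ^ P * H R ^ 2 ≤ H (l * R)) :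
    ¬ Tendsto H atTop atTop := by
  intro hT
  obtain ⟨R₀, hR₀⟩ := eventually_atTop.1 hstep
  -- Chosen so that `c * D = 4 ^ (P + 1) * 2 ^ (P + 1)`: the first factor absorbs the loss `(e / 4)
  -- ^ (P + 1)`, the second supplies the geometric growth. The exponent `P + 1` keeps the ratio
  -- above `1` even when `P = 0`.
  set D : ℝ := 8 ^ (P + 1) / c with hD
  have hD0 : 0 < D := by positivity
  obtain ⟨R₁, h1, h2, h3⟩ := ((eventually_ge_atTop R₀).and ((eventually_ge_atTop 1).and
    (hT.eventually_ge_atTop D))).exists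
  -- The radii stay in `[R₁, 2 * R₁]`. Consecutive ratios exceed `1` by at least `2 ^ (-k) / 4`, a
  -- geometric loss that squaring outweighs.
  have hiter : ∀ k : ℕ, D * (2 ^ (P + 1)) ^ k ≤ H (R₁ * (2 - (1 / 2) ^ k)) := by
    intro k
    induction k with
    | zero => norm_num; exact h3
    | succ k ih =>
      have he0 : (0 : ℝ) < (1 / 2) ^ k := by positivity
      have he1 : ((1 : ℝ) / 2) ^ k ≤ 1 := pow_le_one₀ (by norm_num) (by norm_num)
      set e : ℝ := (1 / 2) ^ k with he
      set r := R₁ * (2 - e) with hr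
      set l := (2 - e / 2) / (2 - e) with hl
      have hden : 0 < 2 - e := by linarith
      have hl1 : e / 4 ≤ l - 1 := by
        rw [hl, div_sub_one hden.ne', le_div_iff₀ hden]
        nlinarith
      have hl2 : l ≤ 2 := by rw [hl, div_le_iff₀ hden]; linarith
      have hlr : R₁ * (2 - (1 / 2) ^ (k + 1)) = l * r := by
        rw [hl, hr, pow_succ, ← he]
        field_simp
      rw [hlr]
      refine le_trans ?_ (hR₀ r (by nlinarith) l (by linarith) hl2)
      have hpos : 0 < D * (2 ^ (P + 1)) ^ k := by positivity
      calc D * (2 ^ (P + 1)) ^ (k + 1)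
          = c * (e / 4) ^ (P + 1) * (D * (2 ^ (P + 1)) ^ k) ^ 2 := by
            have hek : e ^ (P + 1) * (2 ^ (P + 1)) ^ k = 1 := by
              rw [he, ← pow_mul, mul_comm k, pow_mul, ← mul_pow, ← mul_pow]
              norm_num
            have h8 : (8 : ℝ) ^ (P + 1) = 4 ^ (P + 1) * 2 ^ (P + 1) := by
              rw [← mul_pow]; norm_num
            have hcD : c * D = 4 ^ (P + 1) * 2 ^ (P + 1) := by
              rw [← h8, hD]; field_simp
            rw [div_pow, pow_succ]
            calc D * ((2 ^ (P + 1)) ^ k * 2 ^ (P + 1))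
                = (4 ^ (P + 1) * 2 ^ (P + 1)) / 4 ^ (P + 1) * D * (2 ^ (P + 1)) ^ k *
                  (e ^ (P + 1) * (2 ^ (P + 1)) ^ k) := by
                  rw [hek]; field_simp
              _ = _ := by rw [← hcD]; ring
        _ ≤ c * (l - 1) ^ P * H r ^ 2 := by
            have h4 : (e / 4) ^ (P + 1) ≤ (l - 1) ^ P :=
              (pow_le_pow_of_le_one (by positivity) (by linarith) P.le_succ).trans
                (pow_le_pow_left₀ (by positivity) hl1 P)
            have h5 := pow_le_pow_left₀ hpos.le ih 2
            have : 0 ≤ (l - 1) ^ P := pow_nonneg (by linarith) _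
            gcongr
  obtain ⟨B, hB⟩ := (isCompact_Icc (a := R₁) (b := 2 * R₁)).exists_bound_of_continuousOn
    hH.continuousOn
  have hlim : Tendsto (fun k : ℕ => D * ((2 : ℝ) ^ (P + 1)) ^ k) atTop atTop :=
    (tendsto_pow_atTop_atTop_of_one_lt (one_lt_pow₀ one_lt_two P.succ_ne_zero)).const_mul_atTop hD0
  obtain ⟨k, hk⟩ := (hlim.eventually_gt_atTop B).exists
  have he0 : (0 : ℝ) ≤ (1 / 2) ^ k := by positivity
  have he1 : ((1 : ℝ) / 2) ^ k ≤ 1 := pow_le_one₀ (by norm_num) (by norm_num)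
  have := hB (R₁ * (2 - (1 / 2) ^ k)) ⟨by nlinarith, by nlinarith⟩
  exact absurd ((hk.trans_le (hiter k)).trans_le ((le_abs_self _).trans this)) (lt_irrefl _)

/-- Growth of the means of `u` passes to those of `v` by dilation with `l = 2`. The two cross
estimates then close up into one superlinear estimate for the minimum of the two means. -/
theorem not_tendsto_ballMean_of_superlinear (hN : 1 ≤ N) {m : ℕ} {Φ Ψ : ℝ → ℝ}
    (hΦ : IsAdmissibleKernel N Φ) (hΨ : IsAdmissibleKernel N Ψ) {p₁ q₁ p₂ q₂ : ℝ}
    (hp₁ : 0 < p₁) (hq₁ : 0 < q₁) (hp₂ : 0 < p₂) (hq₂ : 0 < q₂) (h₁ : 2 ≤ p₁ + q₁)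
    (h₂ : 2 ≤ p₂ + q₂) {u v : RN N → ℝ} (huv : IsNonnegSolution m Φ Ψ p₁ q₁ p₂ q₂ u v)
    (a : RN N) : ¬ Tendsto (ballMean u a) atTop atTop := by
  intro hJu
  have hu := huv.contDiff_u.continuous
  have hv := huv.contDiff_v.continuous
  obtain ⟨c₂, hc₂, hs₂⟩ := exists_mul_sq_ballMean_le hN hΨ hp₂ hq₂ h₂ hu huv.nonneg_u
    huv.finiteTail_u huv.contDiff_v huv.nonneg_v huv.ineq_v a hJu
  have hJv : Tendsto (ballMean v a) atTop atTop := by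
    have h1 : Tendsto (fun R => c₂ * ballMean u a R ^ 2) atTop atTop :=
      ((tendsto_pow_atTop two_ne_zero).comp hJu).const_mul_atTop hc₂
    have h2 : Tendsto (fun R => ballMean v a (2 * R)) atTop atTop := by
      refine tendsto_atTop_mono' _ ?_ h1
      filter_upwards [hs₂] with R hR
      have := hR 2 one_lt_two le_rfl
      norm_num at this
      exact this
    have h3 := h2.comp (tendsto_id.const_mul_atTop (r := (2 : ℝ)⁻¹) (by norm_num))
    refine h3.congr fun R => ?_
    simp
  obtain ⟨c₁, hc₁, hs₁⟩ := exists_mul_sq_ballMean_le hN hΦ hp₁ hq₁ h₁ hv huv.nonneg_v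
    huv.finiteTail_v huv.contDiff_u huv.nonneg_u huv.ineq_u a hJv
  refine not_tendsto_of_superlinear ((continuous_ballMean hu a).min (continuous_ballMean hv a))
    (lt_min hc₁ hc₂) (2 * m + 1) ?_ (tendsto_atTop.2 fun b => ?_)
  · filter_upwards [hs₁, hs₂, hJu.eventually_ge_atTop 0, hJv.eventually_ge_atTop 0]
      with R h1 h2 hu0 hv0 l hl hl2
    have hl1 : 0 ≤ (l - 1) ^ (2 * m + 1) := pow_nonneg (by linarith) _
    have hmin : 0 ≤ min (ballMean u a R) (ballMean v a R) := le_min hu0 hv0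
    refine le_min (le_trans ?_ (h1 l hl hl2)) (le_trans ?_ (h2 l hl hl2))
    · gcongr
      · exact min_le_left _ _
      · exact min_le_right _ _
    · gcongr
      · exact min_le_right _ _
      · exact min_le_left _ _
  · filter_upwards [hJu.eventually_ge_atTop b, hJv.eventually_ge_atTop b] with R h1 h2
    exact le_min h1 h2

theorem IsNonnegSolution.symm {m : ℕ} {Φ Ψ : ℝ → ℝ} {p₁ q₁ p₂ q₂ : ℝ} {u v : RN N → ℝ}
    (h : IsNonnegSolution m Φ Ψ p₁ q₁ p₂ q₂ u v) : IsNonnegSolution m Ψ Φ p₂ q₂ p₁ q₁ v u :=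
  ⟨h.contDiff_v, h.contDiff_u, h.nonneg_v, h.nonneg_u, h.finiteTail_u, h.finiteTail_v, h.ineq_v,
    h.ineq_u⟩

/-- It suffices to treat `u`, because the hypotheses are symmetric under exchanging the two
components together with their data. -/
theorem IsNonnegSolution.negLaplacianPow_nonneg (hN : 1 ≤ N) {m : ℕ} {Φ Ψ : ℝ → ℝ}
    (hΦ : IsAdmissibleKernel N Φ) (hΨ : IsAdmissibleKernel N Ψ) {p₁ q₁ p₂ q₂ : ℝ}
    (hp₁ : 0 < p₁) (hq₁ : 0 < q₁) (hp₂ : 0 < p₂) (hq₂ : 0 < q₂)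
    (hpq : (2 ≤ p₁ + q₁ ∧ 2 ≤ p₂ + q₂) ∨ (1 ≤ p₁ ∧ 1 ≤ p₂)) {u v : RN N → ℝ}
    (huv : IsNonnegSolution m Φ Ψ p₁ q₁ p₂ q₂ u v) {i : ℕ} (hi : 1 ≤ i) (him : i ≤ m) (x : RN N) :
    0 ≤ negLaplacianPow i u x := by
  induction him using Nat.decreasingInduction generalizing x with
  | self =>
    exact (mul_nonneg (radialConv_nonneg hN hΦ p₁ huv.nonneg_v x)
      (Real.rpow_nonneg (huv.nonneg_v x) q₁)).trans (huv.ineq_u x)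
  | of_succ i him ih =>
    by_contra! hx
    obtain ⟨c, hc, hgrow⟩ := exists_mul_pow_le_ballMean
      (huv.contDiff_u.of_le (by norm_cast; omega)) huv.nonneg_u (ih (by omega)) hx
    have hJ : Tendsto (ballMean u x) atTop atTop := by
      refine tendsto_atTop_mono' _ ?_
        ((tendsto_pow_atTop (α := ℝ) (n := 2 * i) (by omega)).const_mul_atTop hc)
      filter_upwards [eventually_ge_atTop 0] with R hR using hgrow R hR
    rcases hpq with ⟨h₁, h₂⟩ | ⟨-, h₂⟩
    · exact not_tendsto_ballMean_of_superlinear hN hΦ hΨ hp₁ hq₁ hp₂ hq₂ h₁ h₂ huv x hJ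
    · exact huv.finiteTail_u.not_tendsto_ballMean hΨ h₂ huv.contDiff_u.continuous huv.nonneg_u x hJ

end Growth

theorem theorem4p1 (N m : ℕ) (hN : 1 ≤ N) (hm : 1 ≤ m) (Φ Ψ : ℝ → ℝ)
    (hΦ : IsAdmissibleKernel N Φ) (hΨ : IsAdmissibleKernel N Ψ)
    (p₁ q₁ p₂ q₂ : ℝ) (hp₁ : 0 < p₁) (hq₁ : 0 < q₁) (hp₂ : 0 < p₂) (hq₂ : 0 < q₂)
    (hpq : (2 ≤ p₁ + q₁ ∧ 2 ≤ p₂ + q₂) ∨ (1 ≤ p₁ ∧ 1 ≤ p₂))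
    (u v : RN N → ℝ) (huv : IsNonnegSolution m Φ Ψ p₁ q₁ p₂ q₂ u v) :
    ∀ i : ℕ, 1 ≤ i → i ≤ m →
      (∀ x, 0 ≤ negLaplacianPow i u x) ∧ (∀ x, 0 ≤ negLaplacianPow i v x) := by
  intro i hi him
  exact ⟨huv.negLaplacianPow_nonneg hN hΦ hΨ hp₁ hq₁ hp₂ hq₂ hpq hi him,
    huv.symm.negLaplacianPow_nonneg hN hΨ hΦ hp₂ hq₂ hp₁ hq₁
      (hpq.imp And.symm And.symm) hi him⟩
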